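/- Let $X\in\mathbb{R}^{n\times m}$ and let $I_1,\dots,I_t$ be a partition of $\{1,\dots,m\}$ into nonempty sets. Write $X_{I_i}$ for the submatrix of the columns of $X$ indexed by $I_i$, $b_{I_i}$ for the corresponding restriction of $b\in\mathbb{R}^m$, $l_i=\operatorname{rank}X_{I_i}$, and $\|b\|_{X,I}=(\|X_{I_1}b_{I_1}\|_2,\dots,\|X_{I_t}b_{I_t}\|_2)^{\mathsf T}$. Assume that $X_{I_i}^{\mathsf T}X_{I_j}=0$ for $i\ne j$. Consider the linear model $y=X\beta+\varepsilon$ with $\beta\in\mathbb{R}^m$ and $\varepsilon\sim N(0,\sigma^2I_n)$, $\sigma>0$. Let $w_1,\dots,w_t>0$ be weights (for instance the group sizes $|I_i|$), $W=\operatorname{diag}(w_1,\dots,w_t)$, $k\in\{1,\dots,t\}$, $\alpha\in(0,1)$, and let $M\ge t$ be an integer (for instance the number $M=m$ of variables, or the number $M=t$ of groups). For $i=1,\dots,t$ put $$\lambda_{gk}(i)=\begin{cases}\displaystyle\max_{1\le j\le t}\frac1{w_j}F^{-1}_{\chi_{l_j}}\Bigl(1-\frac{k\alpha}{2M}\Bigr),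 & i\le k,\\[2ex] \displaystyle\max_{1\le j\le t}\frac1{w_j}F^{-1}_{\chi_{l_j}}\Bigl(1-\frac{k\alpha}{2(M+k-i)}\Bigr), & i>k,\end{cases}$$ where $F_{\chi_l}$ is the cumulative distribution function of the $\chi$ distribution with $l$ degrees of freedom (the law of the square root of a $\chi^2_l$ variable; the point mass at $0$ if $l=0$) and $F^{-1}(u)=\inf\{x: u\le F(x)\}$. The g$k$-SLOPE problem is $$\min_{b\in\mathbb{R}^m}\ \tfrac12\|y-Xb\|_2^2+\sigma J_{\lambda_{gk}}\bigl(W\|b\|_{X,I}\bigr),\qquad J_\lambda(v)=\sum_{i=1}^t\lambda(i)\,v_{(i)},\quad v_{(1)}\ge\dots\ge v_{(t)}.$$ Then for every $y\in\mathbb{R}^n$ the problem has a solution, and all its solutions $\beta^{gS}$ have the same vector $\|\beta^{gS}\|_{X,I}$. Moreover, with $Vg=\#\{i:\|X_{I_i}\beta_{I_i}\|_2=0,\ \|X_{I_i}\beta^{gS}_{I_i}\|_2\ne0\}$ the number of falsely selected groups, the group $k$-FWER is controlled: $P(Vg\ge k)<\alpha$. -/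

import Mathlib

open MeasureTheory ProbabilityTheory
open scoped Matrix

noncomputable section

namespace GroupSlope

/-- The chi-squared distribution with `l` degrees of freedom: the law of the sum of the squares
of `l` independent standard normal variables. -/
def chiSquaredMeasure (l : ℕ) : Measure ℝ :=
  (stdGaussian (EuclideanSpace ℝ (Fin l))).map (fun z => ∑ i, z i ^ 2)

/-- The chi distribution with `l` degrees of freedom: the law of the square root of a chi-squared
variable with `l` degrees of freedom. -/
def chiMeasure (l : ℕ) : Measure ℝ :=
  (chiSquaredMeasure l).map Real.sqrt

/-- The quantile function `u ↦ inf {x | u ≤ F x}` of the chi distribution with `l` degrees of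
freedom, where `F` is its cumulative distribution function. -/
def chiQuantile (l : ℕ) (u : ℝ) : ℝ :=
  sInf {x : ℝ | u ≤ cdf (chiMeasure l) x}

/-- The submatrix of `X` made of the columns with index in `S`. -/
def groupMatrix {n m : ℕ} (X : Matrix (Fin n) (Fin m) ℝ) (S : Finset (Fin m)) :
    Matrix (Fin n) S ℝ :=
  X.submatrix id (fun j : S => (j : Fin m))

/-- The vector `‖b‖_{X,I}` of the group effects: entry `i` is the Euclidean norm of
`X_{I_i} b_{I_i}`. -/
def groupNorm {n m t : ℕ} (X : Matrix (Fin n) (Fin m) ℝ) (I : Fin t → Finset (Fin m))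
    (b : Fin m → ℝ) : Fin t → ℝ :=
  fun i => ‖(WithLp.toLp 2 (groupMatrix X (I i) *ᵥ fun j : (I i) => b j) :
    EuclideanSpace ℝ (Fin n))‖

/-- The entries of `v` in non-increasing order, `v_(1) ≥ v_(2) ≥ ⋯ ≥ v_(t)`; position `i : Fin t`
holds `v_(i+1)`. -/
def sortedDesc {t : ℕ} (v : Fin t → ℝ) : Fin t → ℝ :=
  fun i => v (Tuple.sort v i.rev)

/-- The sorted penalty `J_lam v = ∑_{i=1}^t lam i * v_(i)`; the sequence `lam` is indexed from 1. -/
def sortedPenalty {t : ℕ} (lam : ℕ → ℝ) (v : Fin t → ℝ) : ℝ :=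
  ∑ i : Fin t, lam ((i : ℕ) + 1) * sortedDesc v i

/-- The group SLOPE objective `½ ‖y - X b‖² + σ J_lam (W ‖b‖_{X,I})`, `W = diag w`. -/
def objective {n m t : ℕ} (X : Matrix (Fin n) (Fin m) ℝ) (I : Fin t → Finset (Fin m))
    (w : Fin t → ℝ) (σ : ℝ) (lam : ℕ → ℝ) (y : EuclideanSpace ℝ (Fin n)) (b : Fin m → ℝ) : ℝ :=
  1 / 2 * ‖y - WithLp.toLp 2 (X *ᵥ b)‖ ^ 2
    + σ * sortedPenalty lam (fun i => w i * groupNorm X I b i)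

/-- `b` is a global minimizer of the group SLOPE objective. -/
def IsSolution {n m t : ℕ} (X : Matrix (Fin n) (Fin m) ℝ) (I : Fin t → Finset (Fin m))
    (w : Fin t → ℝ) (σ : ℝ) (lam : ℕ → ℝ) (y : EuclideanSpace ℝ (Fin n)) (b : Fin m → ℝ) : Prop :=
  ∀ b' : Fin m → ℝ, objective X I w σ lam y b ≤ objective X I w σ lam y b'

/-- The stepdown level entering the `i`-th parameter, `i = 1, 2, …`: `k α / (2 M)` if `i ≤ k` and
`k α / (2 (M + k - i))` if `i > k`. -/
def stepdownLevel (k M : ℕ) (α : ℝ) (i : ℕ) : ℝ :=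
  if i ≤ k then k * α / (2 * M) else k * α / (2 * ((M : ℝ) + k - i))

/-- The regularizing sequence `λ_gk(i)`: the maximum over the groups `j` of
`w_j⁻¹ F⁻¹_{χ_{l_j}} (1 - level_i)`, where `l_j` is the rank of `X_{I_j}`. -/
def lambdaGk {n m t : ℕ} (X : Matrix (Fin n) (Fin m) ℝ) (I : Fin t → Finset (Fin m))
    (w : Fin t → ℝ) (k M : ℕ) (α : ℝ) (i : ℕ) : ℝ :=
  ⨆ j : Fin t, 1 / w j * chiQuantile (groupMatrix X (I j)).rank (1 - stepdownLevel k M α i)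

/-- `Vg`: the number of groups with no effect under the true coefficients `β` that are selected
by the estimate `b`. -/
def falseGroups {n m t : ℕ} (X : Matrix (Fin n) (Fin m) ℝ) (I : Fin t → Finset (Fin m))
    (β b : Fin m → ℝ) : ℕ :=
  {i : Fin t | groupNorm X I β i = 0 ∧ groupNorm X I b i ≠ 0}.ncard

end GroupSlope

end

/-! Since the groups are orthogonal, `X_{I_i} b_{I_i}` is the projection of `X b` onto the column
space of `X_{I_i}`, and these projections of the noise are independent, their norms divided by σ
having χ laws with `l_i` degrees of freedom.

The objective is thus a function of the fitted vector, coercive and strictly convex in it. So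
solutions exist and share their fit, hence their group norms (`exists_isSolution`,
`groupNorm_eq_of_isSolution`).

For error control, compare a solution with `R` selected groups to the vector obtained by dropping
one of them, `i`. Optimality forces the projection of `y` on group `i` to have norm above `σ w_i
λ(R)` (`lt_norm_orthogonalProjectionOnto_of_isSolution`). Let `N` groups be null and `r ≥ k` of them
be selected. Then `R ≤ t - N + r`, so `r` independent χ variables exceed their quantiles at one
minus the level of index `t - N + r`. That level is at most `r α / (2N)` (`stepdownLevel_le_simes`),
so Simes' inequality (`measureReal_exists_le_exceedCount_le`) bounds the probability by `N · α /
(2N) = α / 2 < α`. -/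

namespace GroupSlope

/-! ### The sorted penalty -/

section Penalty

variable {t : ℕ} {lam : ℕ → ℝ}

theorem sortedDesc_antitone (v : Fin t → ℝ) : Antitone (sortedDesc v) := fun _ _ hij =>
  Tuple.monotone_sort v (Fin.rev_le_rev.mpr hij)

theorem exists_perm_sortedPenalty (lam : ℕ → ℝ) (v : Fin t → ℝ) :
    ∃ π : Equiv.Perm (Fin t), Antitone (v ∘ π) ∧
      sortedPenalty lam v = ∑ i : Fin t, lam ((i : ℕ) + 1) * v (π i) :=
  ⟨Fin.revPerm.trans (Tuple.sort v), sortedDesc_antitone v, rfl⟩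

/-- The parameters `lam 1, …, lam t` are non-increasing. -/
def DecreasingUpTo (t : ℕ) (lam : ℕ → ℝ) : Prop :=
  ∀ i j, 1 ≤ i → i ≤ j → j ≤ t → lam j ≤ lam i

/-- The rearrangement inequality. It makes the penalty a maximum of finitely many linear forms, the
source of its monotonicity, convexity and continuity. -/
theorem sum_perm_le_sortedPenalty (h : DecreasingUpTo t lam) (v : Fin t → ℝ)
    (π : Equiv.Perm (Fin t)) :
    ∑ i : Fin t, lam ((i : ℕ) + 1) * v (π i) ≤ sortedPenalty lam v := by
  obtain ⟨τ, hτ, hJ⟩ := exists_perm_sortedPenalty lam v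
  have hl : Antitone fun i : Fin t => lam ((i : ℕ) + 1) := fun i j hij =>
    h _ _ (by omega) (by simpa using hij) (by omega)
  have := (hl.monovary hτ).sum_mul_comp_perm_le_sum_mul (σ := π.trans τ.symm)
  simpa [hJ] using this

theorem sortedPenalty_mono (h : DecreasingUpTo t lam) (h0 : ∀ i, 1 ≤ i → i ≤ t → 0 ≤ lam i)
    {u v : Fin t → ℝ} (huv : ∀ i, u i ≤ v i) : sortedPenalty lam u ≤ sortedPenalty lam v := by
  obtain ⟨π, -, hJ⟩ := exists_perm_sortedPenalty lam u
  rw [hJ]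
  refine le_trans (Finset.sum_le_sum fun i _ => ?_) (sum_perm_le_sortedPenalty h v π)
  exact mul_le_mul_of_nonneg_left (huv _) (h0 _ (by omega) (by omega))

theorem sortedPenalty_nonneg (h0 : ∀ i, 1 ≤ i → i ≤ t → 0 ≤ lam i) {v : Fin t → ℝ}
    (hv : ∀ i, 0 ≤ v i) : 0 ≤ sortedPenalty lam v :=
  Finset.sum_nonneg fun i _ => mul_nonneg (h0 _ (by omega) (by omega)) (hv _)

theorem sortedPenalty_midpoint_le (h : DecreasingUpTo t lam) (u v : Fin t → ℝ) :
    sortedPenalty lam (fun i => (u i + v i) / 2)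
      ≤ (sortedPenalty lam u + sortedPenalty lam v) / 2 := by
  obtain ⟨π, -, hJ⟩ := exists_perm_sortedPenalty lam fun i => (u i + v i) / 2
  have h1 := sum_perm_le_sortedPenalty h u π
  have h2 := sum_perm_le_sortedPenalty h v π
  have : sortedPenalty lam (fun i => (u i + v i) / 2) =
      (∑ i : Fin t, lam ((i : ℕ) + 1) * u (π i) + ∑ i : Fin t, lam ((i : ℕ) + 1) * v (π i)) / 2 := by
    rw [hJ, ← Finset.sum_add_distrib, Finset.sum_div]
    exact Finset.sum_congr rfl fun i _ => by ring
  linarith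

theorem continuous_sortedPenalty (h : DecreasingUpTo t lam) :
    Continuous (sortedPenalty (t := t) lam) := by
  have : sortedPenalty (t := t) lam = fun v => Finset.univ.sup' ⟨1, Finset.mem_univ _⟩
      fun π : Equiv.Perm (Fin t) => ∑ i : Fin t, lam ((i : ℕ) + 1) * v (π i) := by
    funext v
    apply le_antisymm
    · obtain ⟨π, -, hJ⟩ := exists_perm_sortedPenalty lam v
      rw [hJ]
      exact Finset.le_sup' (fun π : Equiv.Perm (Fin t) => ∑ i : Fin t, lam ((i : ℕ) + 1) * v (π i))
        (Finset.mem_univ π)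
    · exact Finset.sup'_le _ _ fun π _ => sum_perm_le_sortedPenalty h v π
  rw [this]
  refine Continuous.finset_sup'_apply _ fun π _ => ?_
  fun_prop

/-- Setting a nonzero entry to zero lowers the penalty by at least the entry times the parameter
whose index is the number of nonzero entries. -/
theorem sortedPenalty_update_zero_add_le (h : DecreasingUpTo t lam) {v : Fin t → ℝ}
    (hv : ∀ i, 0 ≤ v i) {i : Fin t} (hi : v i ≠ 0) :
    sortedPenalty lam (Function.update v i 0)
      + lam (Finset.univ.filter fun j => v j ≠ 0).card * v i ≤ sortedPenalty lam v := by
  set R := (Finset.univ.filter fun j => v j ≠ 0).card with hR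
  set v' := Function.update v i 0 with hv'
  have hR0 : 0 < R := Finset.card_pos.mpr ⟨i, by simpa using hi⟩
  have hRt : R ≤ t := by simpa using Finset.card_le_univ (Finset.univ.filter fun j => v j ≠ 0)
  have hv'0 : ∀ j, 0 ≤ v' j := fun j => by
    by_cases hj : j = i
    · simp [hv', hj]
    · simp [hv', hj, hv]
  obtain ⟨τ, hτ, hJ⟩ := exists_perm_sortedPenalty lam v'
  -- Positions start at 0 and parameters at 1, so `p` carries `lam R`. As `v'` has only `R - 1`
  -- nonzero entries, its sorted entry at `p` is 0.
  let p : Fin t := ⟨R - 1, by omega⟩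
  have hcard : (Finset.univ.filter fun j => v' j ≠ 0).card = R - 1 := by
    have : (Finset.univ.filter fun j => v' j ≠ 0)
        = (Finset.univ.filter fun j => v j ≠ 0).erase i := by
      ext j
      by_cases hj : j = i <;> simp [hv', hj]
    rw [this, Finset.card_erase_of_mem (by simpa using hi)]
  have hp : v' (τ p) = 0 := by
    by_contra hne
    have hsub : (Finset.Iic p).map τ.toEmbedding ⊆ Finset.univ.filter fun j => v' j ≠ 0 := by
      intro j hj
      obtain ⟨q, hq, rfl⟩ := Finset.mem_map.mp hj
      have h1 : v' (τ p) ≤ v' (τ q) := hτ (Finset.mem_Iic.mp hq)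
      have h2 : 0 < v' (τ p) := lt_of_le_of_ne (hv'0 _) (Ne.symm hne)
      simpa using (h2.trans_le h1).ne'
    have := Finset.card_le_card hsub
    rw [Finset.card_map, Fin.card_Iic, hcard] at this
    simp only [p] at this
    omega
  -- The swap exchanges two zeros of `v'`, so `π` still sorts `v'` and now puts `i` at `p`. Along
  -- `π` the sums for `v` and `v'` differ only by `lam R * v i`.
  let π : Equiv.Perm (Fin t) := τ.trans (Equiv.swap (τ p) i)
  have hπ : ∀ q, v' (π q) = v' (τ q) := by
    intro q
    simp only [π, Equiv.trans_apply]
    rcases eq_or_ne (τ q) (τ p) with h1 | h1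
    · rw [h1, Equiv.swap_apply_left, hp]; simp [hv']
    · rcases eq_or_ne (τ q) i with h2 | h2
      · rw [h2, Equiv.swap_apply_right, hp]; simp [hv']
      · rw [Equiv.swap_apply_of_ne_of_ne h1 h2]
  have hpi : π p = i := by simp [π]
  have hsum : ∑ q : Fin t, lam ((q : ℕ) + 1) * v (π q)
      = ∑ q : Fin t, lam ((q : ℕ) + 1) * v' (τ q) + lam R * v i := by
    have : lam R * v i = ∑ q : Fin t, if q = p then lam R * v i else 0 := by simp
    rw [this, ← Finset.sum_add_distrib]
    refine Finset.sum_congr rfl fun q _ => ?_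
    rw [← hπ q]
    by_cases hq : q = p
    · have : (p : ℕ) + 1 = R := by simp only [p]; omega
      simp [hq, hpi, hv', this]
    · have : π q ≠ i := fun h' => hq (π.injective (h'.trans hpi.symm))
      simp [hq, hv', this]
  rw [hJ, ← hsum]
  exact sum_perm_le_sortedPenalty h v π

end Penalty

/-! ### Column spaces of the groups -/

section Design

variable {n m t : ℕ}

/-- The linear map `b ↦ X_S b_S`. -/
noncomputable def groupMap (X : Matrix (Fin n) (Fin m) ℝ) (S : Finset (Fin m)) :
    (Fin m → ℝ) →ₗ[ℝ] EuclideanSpace ℝ (Fin n) :=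
  (WithLp.linearEquiv 2 ℝ (Fin n → ℝ)).symm.toLinearMap ∘ₗ (groupMatrix X S).mulVecLin ∘ₗ
    LinearMap.funLeft ℝ ℝ (fun j : S => (j : Fin m))

/-- The column space of `X_S`. -/
noncomputable def groupSpace (X : Matrix (Fin n) (Fin m) ℝ) (S : Finset (Fin m)) :
    Submodule ℝ (EuclideanSpace ℝ (Fin n)) :=
  LinearMap.range (groupMap X S)

/-- The linear map `b ↦ X b`. -/
noncomputable def designMap (X : Matrix (Fin n) (Fin m) ℝ) :
    (Fin m → ℝ) →ₗ[ℝ] EuclideanSpace ℝ (Fin n) :=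
  (WithLp.linearEquiv 2 ℝ (Fin n → ℝ)).symm.toLinearMap ∘ₗ X.mulVecLin

variable {X : Matrix (Fin n) (Fin m) ℝ} {I : Fin t → Finset (Fin m)}

theorem groupNorm_eq (b : Fin m → ℝ) (i : Fin t) : groupNorm X I b i = ‖groupMap X (I i) b‖ := rfl

theorem groupMap_apply (S : Finset (Fin m)) (b : Fin m → ℝ) (a : Fin n) :
    groupMap X S b a = ∑ j ∈ S, X a j * b j := by
  rw [← Finset.sum_coe_sort]
  rfl

theorem finrank_groupSpace (S : Finset (Fin m)) :
    Module.finrank ℝ (groupSpace X S) = (groupMatrix X S).rank := by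
  have hsurj : LinearMap.range (LinearMap.funLeft ℝ ℝ (fun j : S => (j : Fin m))) = ⊤ :=
    LinearMap.range_eq_top.mpr (LinearMap.funLeft_surjective_of_injective _ _ _
      Subtype.val_injective)
  rw [groupSpace, groupMap, LinearMap.range_comp, LinearMap.range_comp, hsurj, Submodule.map_top,
    Matrix.rank]
  exact LinearEquiv.finrank_map_eq _ _

theorem groupMap_congr {S : Finset (Fin m)} {b b' : Fin m → ℝ} (h : ∀ j ∈ S, b j = b' j) :
    groupMap X S b = groupMap X S b' := by
  ext a
  rw [groupMap_apply, groupMap_apply]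
  exact Finset.sum_congr rfl fun j hj => by rw [h j hj]

theorem designMap_eq_sum (hdisj : ∀ i j, i ≠ j → Disjoint (I i) (I j))
    (hcover : ∀ a : Fin m, ∃ i, a ∈ I i) (b : Fin m → ℝ) :
    designMap X b = ∑ i, groupMap X (I i) b := by
  ext a
  have hun : (Finset.univ : Finset (Fin t)).biUnion I = Finset.univ := by
    ext j
    simpa using hcover j
  rw [WithLp.ofLp_sum, Finset.sum_apply]
  simp only [groupMap_apply]
  rw [← Finset.sum_biUnion fun i _ j _ hij => hdisj i j hij, hun]
  rfl

/-- The Gram condition `X_{I_i}ᵀ X_{I_j} = 0` for `i ≠ j`. -/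
def OrthogonalGroups (X : Matrix (Fin n) (Fin m) ℝ) (I : Fin t → Finset (Fin m)) : Prop :=
  ∀ i j, i ≠ j → (groupMatrix X (I i))ᵀ * groupMatrix X (I j) = 0

theorem inner_groupMap_eq_zero (horth : OrthogonalGroups X I) {i j : Fin t} (hij : i ≠ j)
    (b b' : Fin m → ℝ) : inner ℝ (groupMap X (I i) b) (groupMap X (I j) b') = 0 := by
  have h : inner ℝ (groupMap X (I i) b) (groupMap X (I j) b') =
      (groupMatrix X (I j) *ᵥ fun a : I j => b' a) ⬝ᵥ (groupMatrix X (I i) *ᵥ fun a : I i => b a) :=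
    rfl
  rw [h, Matrix.dotProduct_mulVec, ← Matrix.mulVec_transpose, Matrix.mulVec_mulVec, horth i j hij]
  simp

theorem isOrtho_groupSpace (horth : OrthogonalGroups X I) {i j : Fin t} (hij : i ≠ j) :
    groupSpace X (I i) ⟂ groupSpace X (I j) := by
  rw [Submodule.isOrtho_iff_inner_eq]
  rintro _ ⟨b, rfl⟩ _ ⟨b', rfl⟩
  exact inner_groupMap_eq_zero horth hij b b'

variable (hdisj : ∀ i j, i ≠ j → Disjoint (I i) (I j)) (hcover : ∀ a : Fin m, ∃ i, a ∈ I i)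
  (horth : OrthogonalGroups X I)

include hdisj hcover horth in
/-- The group component `X_{I_i} b_{I_i}` is the orthogonal projection of `X b`. -/
theorem orthogonalProjectionOnto_designMap (b : Fin m → ℝ) (i : Fin t) :
    ((groupSpace X (I i)).orthogonalProjectionOnto (designMap X b) : EuclideanSpace ℝ (Fin n))
      = groupMap X (I i) b := by
  rw [designMap_eq_sum hdisj hcover]
  refine Submodule.eq_starProjection_of_mem_of_inner_eq_zero ⟨b, rfl⟩ ?_
  rintro _ ⟨b', rfl⟩
  rw [inner_sub_left, sum_inner, Finset.sum_eq_single i, sub_self]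
  · exact fun j _ hj => inner_groupMap_eq_zero horth hj _ _
  · simp

end Design

/-! ### Quantiles of the χ distribution -/

section Quantile

instance isProbabilityMeasure_chiSquaredMeasure (l : ℕ) :
    IsProbabilityMeasure (chiSquaredMeasure l) :=
  Measure.isProbabilityMeasure_map (Measurable.aemeasurable (by fun_prop))

instance isProbabilityMeasure_chiMeasure (l : ℕ) : IsProbabilityMeasure (chiMeasure l) :=
  Measure.isProbabilityMeasure_map (Measurable.aemeasurable (by fun_prop))

theorem chiMeasure_eq_map_norm (l : ℕ) :
    chiMeasure l = (stdGaussian (EuclideanSpace ℝ (Fin l))).map fun z => ‖z‖ := by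
  rw [chiMeasure, chiSquaredMeasure, Measure.map_map (by fun_prop) (by fun_prop)]
  congr 1
  funext z
  simp [EuclideanSpace.norm_eq]

theorem cdf_chiMeasure_of_neg (l : ℕ) {x : ℝ} (hx : x < 0) : cdf (chiMeasure l) x = 0 := by
  rw [cdf_eq_real, chiMeasure_eq_map_norm, map_measureReal_apply (by fun_prop) measurableSet_Iic]
  have : (fun z : EuclideanSpace ℝ (Fin l) => ‖z‖) ⁻¹' Set.Iic x = ∅ := by
    ext z
    simpa using hx.trans_le (norm_nonneg z)
  simp [this]

theorem mem_of_le_cdf_chiMeasure {l : ℕ} {u x : ℝ} (hu : 0 < u) (h : u ≤ cdf (chiMeasure l) x) :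
    0 ≤ x := by
  by_contra! hx
  rw [cdf_chiMeasure_of_neg l hx] at h
  linarith

theorem bddBelow_chiQuantile_set (l : ℕ) {u : ℝ} (hu : 0 < u) :
    BddBelow {x : ℝ | u ≤ cdf (chiMeasure l) x} :=
  ⟨0, fun _ hx => mem_of_le_cdf_chiMeasure hu hx⟩

theorem nonempty_chiQuantile_set (l : ℕ) {u : ℝ} (hu : u < 1) :
    {x : ℝ | u ≤ cdf (chiMeasure l) x}.Nonempty := by
  obtain ⟨x, hx⟩ := ((tendsto_cdf_atTop (chiMeasure l)).eventually (eventually_gt_nhds hu)).exists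
  exact ⟨x, hx.le⟩

theorem chiQuantile_nonneg (l : ℕ) {u : ℝ} (hu : 0 < u) : 0 ≤ chiQuantile l u :=
  Real.sInf_nonneg fun _ hx => mem_of_le_cdf_chiMeasure hu hx

theorem chiQuantile_mono (l : ℕ) {u v : ℝ} (hu : 0 < u) (huv : u ≤ v) (hv : v < 1) :
    chiQuantile l u ≤ chiQuantile l v :=
  csInf_le_csInf (bddBelow_chiQuantile_set l hu) (nonempty_chiQuantile_set l hv)
    fun _ hx => huv.trans hx

/-- Right continuity of the distribution function suffices, so the point mass at `l = 0` needs no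
separate treatment. -/
theorem le_cdf_chiQuantile (l : ℕ) {u : ℝ} (hu1 : u < 1) :
    u ≤ cdf (chiMeasure l) (chiQuantile l u) := by
  have hright : Filter.Tendsto (cdf (chiMeasure l)) (nhdsWithin (chiQuantile l u)
      (Set.Ioi (chiQuantile l u))) (nhds (cdf (chiMeasure l) (chiQuantile l u))) :=
    ((cdf (chiMeasure l)).right_continuous _).mono_left (nhdsWithin_mono _ Set.Ioi_subset_Ici_self)
  refine ge_of_tendsto hright ?_
  filter_upwards [self_mem_nhdsWithin] with x hx
  obtain ⟨y, hy, hyx⟩ := exists_lt_of_csInf_lt (nonempty_chiQuantile_set l hu1) hx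
  exact le_trans hy (monotone_cdf _ hyx.le)

/-- The upper tail beyond the quantile at `1 - p` has probability at most `p`. -/
theorem measureReal_Ioi_chiQuantile_le (l : ℕ) {p : ℝ} (hp : 0 < p) :
    (chiMeasure l).real (Set.Ioi (chiQuantile l (1 - p))) ≤ p := by
  have h := le_cdf_chiQuantile l (u := 1 - p) (by linarith)
  rw [cdf_eq_real] at h
  have h2 := probReal_compl_eq_one_sub (μ := chiMeasure l)
    (measurableSet_Iic (a := chiQuantile l (1 - p)))
  rw [Set.compl_Iic] at h2
  linarith

end Quantile

/-! ### Stepdown levels and the regularizing sequence -/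

section Parameters

variable {n m t k M : ℕ} {α : ℝ}

theorem stepdownLevel_pos (hk : 1 ≤ k) (hkt : k ≤ t) (hM : t ≤ M) (hα0 : 0 < α) {i : ℕ}
    (hi : i ≤ t) : 0 < stepdownLevel k M α i := by
  have hk' : (0 : ℝ) < k := by exact_mod_cast hk
  have hM' : (k : ℝ) ≤ M := by exact_mod_cast hkt.trans hM
  have hi' : (i : ℝ) ≤ M := by exact_mod_cast hi.trans hM
  rw [stepdownLevel]
  split_ifs
  · exact div_pos (by positivity) (by linarith)
  · exact div_pos (by positivity) (by linarith)

/-- With positivity and `α < 1`, this keeps one minus the level inside `(0, 1)`, where the sets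
defining the quantiles are nonempty and bounded below. -/
theorem stepdownLevel_le (hk : 1 ≤ k) (hkt : k ≤ t) (hM : t ≤ M) (hα0 : 0 < α) {i : ℕ}
    (hi : i ≤ t) : stepdownLevel k M α i ≤ α / 2 := by
  have hk' : (0 : ℝ) < k := by exact_mod_cast hk
  have hM' : (k : ℝ) ≤ M := by exact_mod_cast hkt.trans hM
  have hi' : (i : ℝ) ≤ M := by exact_mod_cast hi.trans hM
  rw [stepdownLevel]
  split_ifs
  · rw [div_le_div_iff₀ (by linarith) two_pos]
    nlinarith
  · rw [div_le_div_iff₀ (by linarith) two_pos]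
    nlinarith

theorem stepdownLevel_mono (hk : 1 ≤ k) (hM : t ≤ M) (hα0 : 0 < α) {i j : ℕ}
    (hij : i ≤ j) (hj : j ≤ t) : stepdownLevel k M α i ≤ stepdownLevel k M α j := by
  have hk' : (0 : ℝ) < k := by exact_mod_cast hk
  have hj' : (j : ℝ) ≤ M := by exact_mod_cast hj.trans hM
  have hij' : (i : ℝ) ≤ j := by exact_mod_cast hij
  rw [stepdownLevel, stepdownLevel]
  split_ifs with h1 h2 h2
  · exact le_rfl
  · have : (k : ℝ) < j := by exact_mod_cast not_le.mp h2
    exact div_le_div_of_nonneg_left (by positivity) (by linarith) (by linarith)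
  · omega
  · exact div_le_div_of_nonneg_left (by positivity) (by linarith) (by linarith)

/-- With `N` null groups out of `t`, the level at position `t - N + r` is at most `r α / (2 N)`. -/
theorem stepdownLevel_le_simes (hk : 1 ≤ k) (hM : t ≤ M) (hα0 : 0 < α) {N s r : ℕ}
    (hs : s + N = t) (hkr : k ≤ r) (hrN : r ≤ N) :
    stepdownLevel k M α (s + r) ≤ r * (α / (2 * N)) := by
  have hk' : (0 : ℝ) < k := by exact_mod_cast hk
  have hkr' : (k : ℝ) ≤ r := by exact_mod_cast hkr
  have hrN' : (r : ℝ) ≤ N := by exact_mod_cast hrN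
  have hM' : (s : ℝ) + N ≤ M := by exact_mod_cast hs.le.trans hM
  have hs0 : (0 : ℝ) ≤ s := Nat.cast_nonneg s
  rw [stepdownLevel, ← mul_div_assoc]
  -- In the first branch `s + r ≤ k ≤ r`, and `k / M ≤ r / N` is clear. In the second, `M - s ≥ N`
  -- reduces the claim to `k N ≤ r (N + k - r)`, that is, `(r - k)(N - r) ≥ 0`.
  split_ifs
  · exact div_le_div₀ (by positivity) (by gcongr) (by linarith) (by linarith)
  · push_cast
    rw [div_le_div_iff₀ (by linarith) (by linarith)]
    have h1 : 0 ≤ ((r : ℝ) - k) * (N - r) := mul_nonneg (by linarith) (by linarith)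
    have h2 : (k : ℝ) * N ≤ r * (M + k - (s + r)) := by nlinarith
    nlinarith

variable {X : Matrix (Fin n) (Fin m) ℝ} {I : Fin t → Finset (Fin m)} {w : Fin t → ℝ}

theorem chiQuantile_le_mul_lambdaGk (hw : ∀ i, 0 < w i) (j : Fin t) (i : ℕ) :
    chiQuantile (groupMatrix X (I j)).rank (1 - stepdownLevel k M α i)
      ≤ w j * lambdaGk X I w k M α i := by
  have h := le_ciSup (f := fun j : Fin t =>
    1 / w j * chiQuantile (groupMatrix X (I j)).rank (1 - stepdownLevel k M α i))
    (Set.finite_range _).bddAbove j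
  have h2 := mul_le_mul_of_nonneg_left h (hw j).le
  rwa [← mul_assoc, mul_one_div_cancel (hw j).ne', one_mul] at h2

theorem lambdaGk_nonneg (hw : ∀ i, 0 < w i) (hk : 1 ≤ k) (hkt : k ≤ t) (hM : t ≤ M) (hα0 : 0 < α)
    (hα1 : α < 1) {i : ℕ} (hi : i ≤ t) : 0 ≤ lambdaGk X I w k M α i := by
  refine Real.iSup_nonneg fun j => mul_nonneg (one_div_nonneg.mpr (hw j).le) ?_
  refine chiQuantile_nonneg _ ?_
  linarith [stepdownLevel_le hk hkt hM hα0 hi]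

theorem lambdaGk_decreasing (hw : ∀ i, 0 < w i) (hk : 1 ≤ k) (hkt : k ≤ t) (hM : t ≤ M)
    (hα0 : 0 < α) (hα1 : α < 1) : DecreasingUpTo t (lambdaGk X I w k M α) := by
  intro i j _ hij hj
  refine ciSup_mono (Set.finite_range _).bddAbove fun a => ?_
  refine mul_le_mul_of_nonneg_left (chiQuantile_mono _ ?_ ?_ ?_) (one_div_nonneg.mpr (hw a).le)
  · linarith [stepdownLevel_le hk hkt hM hα0 hj]
  · linarith [stepdownLevel_mono (α := α) hk hM hα0 hij hj]
  · linarith [stepdownLevel_pos hk hkt hM hα0 (hij.trans hj)]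

end Parameters

/-! ### Projections of Gaussian vectors -/

section GaussianProjection

variable {E : Type*} [NormedAddCommGroup E] [InnerProductSpace ℝ E] [FiniteDimensional ℝ E]
  [MeasurableSpace E] [BorelSpace E]

theorem stdGaussian_map_orthogonalProjectionOnto (V : Submodule ℝ E) :
    (stdGaussian E).map V.orthogonalProjectionOnto = stdGaussian V := by
  apply Measure.ext_of_charFun
  ext v
  rw [charFun_apply, integral_map (by fun_prop) (by fun_prop)]
  simp_rw [Submodule.inner_orthogonalProjectionOnto_eq_of_mem_right]
  rw [← charFun_apply, charFun_stdGaussian, charFun_stdGaussian, Submodule.coe_norm]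

theorem stdGaussian_map_norm (E : Type*) [NormedAddCommGroup E] [InnerProductSpace ℝ E]
    [FiniteDimensional ℝ E] [MeasurableSpace E] [BorelSpace E] :
    (stdGaussian E).map (fun x => ‖x‖) = chiMeasure (Module.finrank ℝ E) := by
  rw [chiMeasure_eq_map_norm, ← stdGaussian_map (stdOrthonormalBasis ℝ E).repr,
    Measure.map_map (by fun_prop) (by fun_prop)]
  congr 1
  funext x
  simp

/-- The projections are jointly Gaussian, so independence follows from vanishing cross covariances,
which are inner products of vectors from orthogonal subspaces. -/
theorem iIndepFun_orthogonalProjectionOnto {ι : Type*} [Finite ι] (V : ι → Submodule ℝ E)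
    (hV : ∀ i j, i ≠ j → V i ⟂ V j) :
    iIndepFun (fun i x => (V i).orthogonalProjectionOnto x) (stdGaussian E) := by
  have := Fintype.ofFinite ι
  refine HasGaussianLaw.iIndepFun_of_covariance_inner ?_ fun i j hij x y => ?_
  · exact (IsGaussian.hasGaussianLaw_id (μ := stdGaussian E)).map
      (ContinuousLinearMap.pi fun i => (V i).orthogonalProjectionOnto)
  · simp_rw [Submodule.inner_orthogonalProjectionOnto_eq_of_mem_left]
    rw [← covarianceBilin_apply_eq_cov IsGaussian.memLp_two_id, covarianceBilin_stdGaussian]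
    exact Submodule.isOrtho_iff_inner_eq.mp (hV i j hij) x x.2 y y.2

theorem multivariateGaussian_smul_one {ι : Type*} [Fintype ι] [DecidableEq ι] (σ : ℝ) :
    multivariateGaussian 0 ((σ ^ 2) • (1 : Matrix ι ι ℝ))
      = (stdGaussian (EuclideanSpace ℝ ι)).map (σ • ·) := by
  apply Measure.ext_of_charFun
  ext v
  rw [charFun_multivariateGaussian (Matrix.PosSemidef.one.smul (sq_nonneg σ)), charFun_map_smul,
    charFun_stdGaussian, norm_smul]
  congr 1
  have : (v.ofLp ⬝ᵥ v.ofLp) = ‖v‖ ^ 2 := by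
    rw [EuclideanSpace.real_norm_sq_eq, dotProduct]
    exact Finset.sum_congr rfl fun i _ => (sq _).symm
  simp [Matrix.smul_mulVec, this, neg_div, mul_pow, ← Complex.ofReal_pow]

end GaussianProjection

/-! ### Simes' inequality -/

section Simes

variable {ι : Type*} {K : Finset ℕ} {c : ι → ℕ → ℝ}

/-- The number of `j` in `s` with `x j` above the `r`-th threshold. -/
noncomputable def exceedCount (c : ι → ℕ → ℝ) (s : Finset ι) (x : ι → ℝ) (r : ℕ) : ℕ :=
  {j ∈ s | c j r < x j}.card

/-- The largest `r ∈ K` with `r ≤ d + exceedCount c s x r`, and `0` if there is none. -/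
noncomputable def maxLevel (K : Finset ℕ) (c : ι → ℕ → ℝ) (s : Finset ι) (d : ℕ) (x : ι → ℝ) : ℕ :=
  {r ∈ K | r ≤ d + exceedCount c s x r}.sup id

theorem le_maxLevel {s : Finset ι} {d r : ℕ} {x : ι → ℝ} (hr : r ∈ K)
    (h : r ≤ d + exceedCount c s x r) : r ≤ maxLevel K c s d x :=
  Finset.le_sup (f := id) (Finset.mem_filter.mpr ⟨hr, h⟩)

/-- A nonzero value is not the default for an empty set, so the maximum is attained. -/
theorem le_of_maxLevel_eq {s : Finset ι} {d r : ℕ} {x : ι → ℝ} (hr : r ≠ 0)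
    (h : maxLevel K c s d x = r) : r ∈ K ∧ r ≤ d + exceedCount c s x r := by
  have hne : ({r ∈ K | r ≤ d + exceedCount c s x r}).Nonempty := by
    by_contra hemp
    rw [Finset.not_nonempty_iff_eq_empty] at hemp
    exact hr (by rw [← h, maxLevel, hemp]; rfl)
  obtain ⟨q, hq, hq'⟩ := Finset.exists_mem_eq_sup _ hne id
  rw [← maxLevel, h] at hq'
  obtain rfl : r = q := hq'
  exact Finset.mem_filter.mp hq

theorem measurable_exceedCount (s : Finset ι) (r : ℕ) :
    Measurable fun x : ι → ℝ => exceedCount c s x r := by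
  classical
  simp only [exceedCount, Finset.card_filter]
  refine Finset.measurable_sum _ fun j _ => ?_
  exact Measurable.ite (measurableSet_lt measurable_const (measurable_pi_apply j))
    measurable_const measurable_const

theorem measurable_maxLevel (s : Finset ι) (d : ℕ) :
    Measurable fun x : ι → ℝ => maxLevel K c s d x := by
  classical
  have : (fun x : ι → ℝ => maxLevel K c s d x) =
      fun x => K.sup fun r => if r ≤ d + exceedCount c s x r then r else 0 := by
    funext x
    rw [maxLevel]
    apply le_antisymm
    · refine Finset.sup_le fun r hr => ?_
      obtain ⟨h1, h2⟩ := Finset.mem_filter.mp hr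
      simpa [h2] using
        Finset.le_sup (f := fun r => if r ≤ d + exceedCount c s x r then r else 0) h1
    · refine Finset.sup_le fun r hr => ?_
      split_ifs with h
      · exact Finset.le_sup (f := id) (Finset.mem_filter.mpr ⟨hr, h⟩)
      · exact Nat.zero_le _
  rw [this]
  clear this
  induction K using Finset.induction_on with
  | empty => simp
  | insert q K _ ih =>
    simp only [Finset.sup_insert]
    exact (Measurable.ite (measurableSet_le measurable_const
      (measurable_const.add (measurable_exceedCount s q))) measurable_const measurable_const).sup ih

/-- If coordinate `i` exceeds its threshold at the maximal level, that level can be computed from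
the other coordinates. -/
theorem maxLevel_erase_eq [Fintype ι] [DecidableEq ι] (hc : ∀ i, AntitoneOn (c i) K) {x : ι → ℝ} {r : ℕ}
    (hr : r ≠ 0) (h : maxLevel K c Finset.univ 0 x = r) {i : ι} (hi : c i r < x i) :
    maxLevel K c (Finset.univ.erase i) 1 x = r := by
  obtain ⟨hrK, hrc⟩ := le_of_maxLevel_eq hr h
  -- Thresholds do not increase with the level, so `i` exceeds those at every `q ≥ r` as well.
  -- Erasing it lowers each such count by exactly one, which the offset 1 restores.
  have key : ∀ q ∈ K, r ≤ q →
      0 + exceedCount c Finset.univ x q = 1 + exceedCount c (Finset.univ.erase i) x q := by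
    intro q hq hrq
    have hiq : c i q < x i := (hc i hrK hq hrq).trans_lt hi
    have hmem : i ∈ ({j ∈ (Finset.univ : Finset ι) | c j q < x j}) := by simpa using hiq
    rw [exceedCount, exceedCount, Finset.filter_erase, zero_add, add_comm,
      Finset.card_erase_add_one hmem]
  have hle : r ≤ maxLevel K c (Finset.univ.erase i) 1 x :=
    le_maxLevel hrK (by rw [← key r hrK le_rfl]; exact hrc)
  refine le_antisymm ?_ hle
  obtain ⟨h1, h2⟩ := le_of_maxLevel_eq (r := maxLevel K c (Finset.univ.erase i) 1 x)
    (by omega) rfl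
  rw [← key _ h1 hle] at h2
  exact (le_maxLevel h1 h2).trans h.le

/-- Simes' inequality for independent variables, in the form used for step-up procedures. -/
theorem measureReal_exists_le_exceedCount_le [Fintype ι] {Ω : Type*} [MeasurableSpace Ω] {P : Measure Ω}
    [IsProbabilityMeasure P] {T : ι → Ω → ℝ} (hT : ∀ i, Measurable (T i)) (hind : iIndepFun T P)
    (hK : 0 ∉ K) (hc : ∀ i, AntitoneOn (c i) K) {a : ℝ} (ha : 0 ≤ a)
    (hP : ∀ i, ∀ r ∈ K, P.real {ω | c i r < T i ω} ≤ r * a) :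
    P.real {ω | ∃ r ∈ K, r ≤ exceedCount c Finset.univ (fun i => T i ω) r}
      ≤ Fintype.card ι * a := by
  classical
  let A : ι → ℕ → Set Ω := fun i r => {ω | c i r < T i ω}
  let S : ι → ℕ → Set Ω := fun i r =>
    {ω | maxLevel K c (Finset.univ.erase i) 1 (fun j => T j ω) = r}
  let Q : ℕ → Set Ω := fun r => {ω | maxLevel K c Finset.univ 0 (fun j => T j ω) = r}
  have hTm : Measurable fun ω => fun j => T j ω := measurable_pi_lambda _ hT
  have hA : ∀ i r, MeasurableSet (A i r) := fun i r => measurableSet_lt measurable_const (hT i)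
  have hS : ∀ i r, MeasurableSet (S i r) := fun i r =>
    (measurable_maxLevel _ _).comp hTm (measurableSet_singleton r)
  have hQ : ∀ r, MeasurableSet (Q r) := fun r =>
    (measurable_maxLevel _ _).comp hTm (measurableSet_singleton r)
  have hindep : ∀ i r, P.real (A i r ∩ S i r) = P.real (A i r) * P.real (S i r) := by
    intro i r
    have h1 : IndepFun (T i) (fun ω (j : (Finset.univ.erase i : Finset ι)) => T j ω) P := by
      have := hind.indepFun_finset {i} (Finset.univ.erase i) (by simp) hT
      exact this.comp (φ := fun f : ({i} : Finset ι) → ℝ => f ⟨i, by simp⟩)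
        (measurable_pi_apply (X := fun _ : ({i} : Finset ι) => ℝ) _) measurable_id
    -- The filler value 0 at `i` is never read, as the counts run over the other coordinates.
    let extend : (↥(Finset.univ.erase i) → ℝ) → ι → ℝ :=
      fun y j => if hj : j ∈ Finset.univ.erase i then y ⟨j, hj⟩ else 0
    have hext : Measurable extend := by
      refine measurable_pi_lambda _ fun j => ?_
      by_cases hj : j ∈ Finset.univ.erase i
      · simpa only [extend, hj, dite_true] using
          measurable_pi_apply (X := fun _ : ↥(Finset.univ.erase i) => ℝ) ⟨j, hj⟩
      · simpa only [extend, hj, dite_false] using measurable_const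
    have hSeq : S i r = (fun ω (j : (Finset.univ.erase i : Finset ι)) => T j ω) ⁻¹'
        {y | maxLevel K c (Finset.univ.erase i) 1 (extend y) = r} := by
      ext ω
      have : ∀ q, exceedCount c (Finset.univ.erase i) (fun j => T j ω) q =
          exceedCount c (Finset.univ.erase i)
            (extend fun (j : (Finset.univ.erase i : Finset ι)) => T j ω) q := by
        intro q
        rw [exceedCount, exceedCount]
        congr 1
        refine Finset.filter_congr fun j hj => ?_
        simp only [extend, dif_pos hj]
      simp only [S, Set.mem_ofPred_eq, Set.mem_preimage, maxLevel, this]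
    have h2 := h1.measure_inter_preimage_eq_mul (Set.Ioi (c i r))
      {y | maxLevel K c (Finset.univ.erase i) 1 (extend y) = r} measurableSet_Ioi
      ((measurable_maxLevel _ _).comp hext (measurableSet_singleton r))
    rw [← hSeq] at h2
    have h3 : A i r = T i ⁻¹' Set.Ioi (c i r) := rfl
    rw [measureReal_def, h3, h2, ENNReal.toReal_mul]
    rfl
  have hcover : {ω | ∃ r ∈ K, r ≤ exceedCount c Finset.univ (fun i => T i ω) r}
      ⊆ ⋃ r ∈ K, Q r := by
    rintro ω ⟨r, hr, hle⟩
    have hr0 : r ≠ 0 := fun h => hK (h ▸ hr)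
    have h1 : r ≤ maxLevel K c Finset.univ 0 (fun j => T j ω) := le_maxLevel hr (by simpa using hle)
    have := le_of_maxLevel_eq (K := K) (c := c) (s := Finset.univ) (d := 0)
      (x := fun j => T j ω) (by omega) rfl
    exact Set.mem_biUnion this.1 rfl
  have hQle : ∀ r ∈ K, P.real (Q r) ≤ ∑ i, a * P.real (S i r) := by
    intro r hr
    have hr0 : r ≠ 0 := fun h => hK (h ▸ hr)
    have hrpos : (0 : ℝ) < r := by positivity
    -- On `Q r` at least `r` of the events `A i r` occur; integrate this count.
    have h1 : (r : ℝ) * P.real (Q r) ≤ ∑ i, P.real (A i r ∩ Q r) := by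
      have e1 : (r : ℝ) * P.real (Q r) = ∫ ω, (Q r).indicator (fun _ => (r : ℝ)) ω ∂P := by
        rw [integral_indicator_const _ (hQ r), smul_eq_mul, mul_comm]
      have e2 : ∑ i, P.real (A i r ∩ Q r)
          = ∫ ω, ∑ i, (A i r ∩ Q r).indicator (fun _ => (1 : ℝ)) ω ∂P := by
        rw [integral_finsetSum]
        · refine Finset.sum_congr rfl fun i _ => ?_
          rw [integral_indicator_const _ ((hA i r).inter (hQ r)), smul_eq_mul, mul_one]
        · exact fun i _ => (integrable_const _).indicator ((hA i r).inter (hQ r))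
      rw [e1, e2]
      refine integral_mono ((integrable_const _).indicator (hQ r))
        (integrable_finsetSum _ fun i _ =>
          (integrable_const _).indicator ((hA i r).inter (hQ r))) fun ω => ?_
      by_cases hω : ω ∈ Q r
      · have h2 := (le_of_maxLevel_eq hr0 hω).2
        rw [zero_add, exceedCount] at h2
        have : ∑ i, (A i r ∩ Q r).indicator (fun _ => (1 : ℝ)) ω
            = (({j ∈ (Finset.univ : Finset ι) | c j r < T j ω}).card : ℝ) := by
          rw [Finset.card_filter]
          push_cast
          refine Finset.sum_congr rfl fun i _ => ?_
          simp [Set.indicator_apply, hω, A]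
        rw [Set.indicator_of_mem hω]
        dsimp only
        rw [this]
        exact_mod_cast h2
      · rw [Set.indicator_of_notMem hω]
        exact Finset.sum_nonneg fun i _ => Set.indicator_nonneg (fun _ _ => zero_le_one) _
    have h2 : ∑ i, P.real (A i r ∩ Q r) ≤ ∑ i, r * (a * P.real (S i r)) := by
      refine Finset.sum_le_sum fun i _ => ?_
      calc P.real (A i r ∩ Q r) ≤ P.real (A i r ∩ S i r) := by
            refine measureReal_mono fun ω hω => ⟨hω.1, ?_⟩
            exact maxLevel_erase_eq hc hr0 hω.2 hω.1
        _ = P.real (A i r) * P.real (S i r) := hindep i r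
        _ ≤ (r * a) * P.real (S i r) :=
            mul_le_mul_of_nonneg_right (hP i r hr) measureReal_nonneg
        _ = r * (a * P.real (S i r)) := by ring
    rw [← Finset.mul_sum] at h2
    exact le_of_mul_le_mul_left (h1.trans h2) hrpos
  -- For fixed `i` the events `S i r` are disjoint in `r`. Each index therefore contributes at most
  -- `a`.
  have hSsum : ∀ i, ∑ r ∈ K, P.real (S i r) ≤ 1 := by
    intro i
    rw [← measureReal_biUnion_finset]
    · exact measureReal_le_one
    · intro r _ q _ hrq
      exact Set.disjoint_left.mpr fun ω h1 h2 => hrq (h1.symm.trans h2)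
    · exact fun r _ => hS i r
  calc P.real {ω | ∃ r ∈ K, r ≤ exceedCount c Finset.univ (fun i => T i ω) r}
      ≤ P.real (⋃ r ∈ K, Q r) := measureReal_mono hcover (measure_ne_top _ _)
    _ ≤ ∑ r ∈ K, P.real (Q r) := measureReal_biUnion_finset_le _ _
    _ ≤ ∑ r ∈ K, ∑ i, a * P.real (S i r) := Finset.sum_le_sum hQle
    _ = ∑ i, a * ∑ r ∈ K, P.real (S i r) := by
        rw [Finset.sum_comm]
        simp only [Finset.mul_sum]
    _ ≤ ∑ _i : ι, a := Finset.sum_le_sum fun i _ => mul_le_of_le_one_right ha (hSsum i)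
    _ = Fintype.card ι * a := by simp

end Simes

/-! ### Existence, uniqueness and optimality of solutions -/

section Solutions

variable {n m t : ℕ} {X : Matrix (Fin n) (Fin m) ℝ} {I : Fin t → Finset (Fin m)}
  {w : Fin t → ℝ} {σ : ℝ} {lam : ℕ → ℝ} {y : EuclideanSpace ℝ (Fin n)}

theorem objective_eq (b : Fin m → ℝ) : objective X I w σ lam y b =
    1 / 2 * ‖y - designMap X b‖ ^ 2 + σ * sortedPenalty lam (fun i => w i * groupNorm X I b i) :=
  rfl

theorem groupNorm_nonneg (b : Fin m → ℝ) (i : Fin t) : 0 ≤ groupNorm X I b i := norm_nonneg _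

theorem groupNorm_midpoint_le (b b' : Fin m → ℝ) (i : Fin t) :
    groupNorm X I ((1 / 2 : ℝ) • (b + b')) i ≤ (groupNorm X I b i + groupNorm X I b' i) / 2 := by
  simp only [groupNorm_eq, map_smul, map_add, norm_smul]
  have := norm_add_le (groupMap X (I i) b) (groupMap X (I i) b')
  norm_num
  linarith

/-- The objective is strictly convex in the fitted vector. -/
theorem objective_midpoint_le (hw : ∀ i, 0 < w i) (hσ : 0 < σ) (hlam : DecreasingUpTo t lam)
    (hlam0 : ∀ i, 1 ≤ i → i ≤ t → 0 ≤ lam i) (b b' : Fin m → ℝ) :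
    objective X I w σ lam y ((1 / 2 : ℝ) • (b + b')) + ‖designMap X b - designMap X b'‖ ^ 2 / 8
      ≤ (objective X I w σ lam y b + objective X I w σ lam y b') / 2 := by
  have hpen : sortedPenalty lam (fun i => w i * groupNorm X I ((1 / 2 : ℝ) • (b + b')) i) ≤
      (sortedPenalty lam (fun i => w i * groupNorm X I b i)
        + sortedPenalty lam (fun i => w i * groupNorm X I b' i)) / 2 := by
    refine le_trans (sortedPenalty_mono hlam hlam0 fun i => ?_) (sortedPenalty_midpoint_le hlam _ _)
    have := mul_le_mul_of_nonneg_left (groupNorm_midpoint_le (X := X) (I := I) b b' i) (hw i).le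
    linarith
  have hpen' := mul_le_mul_of_nonneg_left hpen hσ.le
  -- The parallelogram law supplies the strict convexity term `‖X b - X b'‖ ^ 2 / 8`.
  have hpar := parallelogram_law_with_norm ℝ (y - designMap X b) (y - designMap X b')
  have h1 : y - designMap X ((1 / 2 : ℝ) • (b + b'))
      = (1 / 2 : ℝ) • ((y - designMap X b) + (y - designMap X b')) := by
    rw [map_smul, map_add]
    module
  have h2 : (y - designMap X b) - (y - designMap X b') = -(designMap X b - designMap X b') := by
    abel
  have h3 : ‖y - designMap X ((1 / 2 : ℝ) • (b + b'))‖ ^ 2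
      = 1 / 4 * ‖(y - designMap X b) + (y - designMap X b')‖ ^ 2 := by
    rw [h1, norm_smul, mul_pow]
    norm_num
  rw [h2, norm_neg] at hpar
  simp only [objective_eq]
  rw [h3]
  nlinarith

variable (hdisj : ∀ i j, i ≠ j → Disjoint (I i) (I j)) (hcover : ∀ a : Fin m, ∃ i, a ∈ I i)
  (horth : OrthogonalGroups X I)

include hdisj hcover horth

/-- The minimization runs over fitted vectors in the closed range of `X`: the objective need not be
coercive in `b` when `X` has a kernel, but is coercive in the fit. -/
theorem exists_isSolution (hw : ∀ i, 0 < w i) (hσ : 0 < σ) (hlam : DecreasingUpTo t lam)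
    (hlam0 : ∀ i, 1 ≤ i → i ≤ t → 0 ≤ lam i) (y : EuclideanSpace ℝ (Fin n)) :
    ∃ b, IsSolution X I w σ lam y b := by
  let g : EuclideanSpace ℝ (Fin n) → ℝ := fun z => 1 / 2 * ‖y - z‖ ^ 2
    + σ * sortedPenalty lam (fun i => w i * ‖(groupSpace X (I i)).orthogonalProjectionOnto z‖)
  have hg : ∀ b, g (designMap X b) = objective X I w σ lam y b := by
    intro b
    simp only [g, objective_eq, groupNorm_eq, Submodule.coe_norm,
      orthogonalProjectionOnto_designMap hdisj hcover horth]
  have hcont : Continuous g := by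
    have h1 := (continuous_sortedPenalty hlam).comp (continuous_pi fun i : Fin t =>
      (continuous_const (y := w i)).mul
        ((groupSpace X (I i)).orthogonalProjectionOnto.continuous.norm))
    exact (by fun_prop : Continuous fun z => 1 / 2 * ‖y - z‖ ^ 2).add (continuous_const.mul h1)
  have hlow : ∀ z, 1 / 2 * ‖y - z‖ ^ 2 ≤ g z := fun z => by
    have := mul_nonneg hσ.le (sortedPenalty_nonneg hlam0
      (v := fun i => w i * ‖(groupSpace X (I i)).orthogonalProjectionOnto z‖)
      fun i => mul_nonneg (hw i).le (norm_nonneg _))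
    simp only [g]
    linarith
  obtain ⟨_, ⟨b, rfl⟩, hb⟩ := hcont.continuousOn.exists_isMinOn'
    (s := (LinearMap.range (designMap X) : Set (EuclideanSpace ℝ (Fin n))))
    (Submodule.closed_of_finiteDimensional _) (x₀ := designMap X 0) ⟨0, rfl⟩ (by
      refine Filter.Eventually.filter_mono inf_le_left ?_
      filter_upwards [(tendsto_norm_cocompact_atTop (E := EuclideanSpace ℝ (Fin n))).eventually
        (Filter.eventually_ge_atTop (‖y‖ + |g (designMap X 0)| + 1))] with z hz
      -- This distance makes the quadratic term alone exceed `g (designMap X 0)`, because `(s + 1) ^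
      -- 2 / 2 ≥ s` for `s ≥ 0`.
      have h1 : |g (designMap X 0)| + 1 ≤ ‖y - z‖ := by
        have := norm_sub_norm_le z y
        rw [norm_sub_rev] at this
        linarith
      have h2 := hlow z
      have h3 := le_abs_self (g (designMap X 0))
      nlinarith [abs_nonneg (g (designMap X 0))])
  refine ⟨b, fun b' => ?_⟩
  rw [← hg, ← hg]
  exact hb ⟨b', rfl⟩

/-- Two solutions with different fits would be beaten by their midpoint. Equal fits have equal
projections, although the coefficients may differ. -/
theorem groupNorm_eq_of_isSolution (hw : ∀ i, 0 < w i) (hσ : 0 < σ)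
    (hlam : DecreasingUpTo t lam) (hlam0 : ∀ i, 1 ≤ i → i ≤ t → 0 ≤ lam i) {b b' : Fin m → ℝ}
    (hb : IsSolution X I w σ lam y b) (hb' : IsSolution X I w σ lam y b') :
    groupNorm X I b = groupNorm X I b' := by
  have h1 := objective_midpoint_le (X := X) (I := I) (y := y) hw hσ hlam hlam0 b b'
  have h2 := hb ((1 / 2 : ℝ) • (b + b'))
  have h3 := hb' ((1 / 2 : ℝ) • (b + b'))
  have h4 : ‖designMap X b - designMap X b'‖ ^ 2 = 0 :=
    le_antisymm (by linarith) (sq_nonneg _)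
  have h5 : designMap X b = designMap X b' := by
    simpa [sub_eq_zero] using h4
  funext i
  rw [groupNorm_eq, groupNorm_eq, ← orthogonalProjectionOnto_designMap hdisj hcover horth, h5,
    orthogonalProjectionOnto_designMap hdisj hcover horth]

/-- A group selected by a solution has a projected response above the threshold given by the
number of selected groups. -/
theorem lt_norm_orthogonalProjectionOnto_of_isSolution (hw : ∀ i, 0 < w i) (hσ : 0 < σ)
    (hlam : DecreasingUpTo t lam) {b : Fin m → ℝ} (hb : IsSolution X I w σ lam y b) {i : Fin t}
    (hi : groupNorm X I b i ≠ 0) :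
    σ * (w i * lam {j | groupNorm X I b j ≠ 0}.ncard)
      < ‖(groupSpace X (I i)).orthogonalProjectionOnto y‖ := by
  set u := groupMap X (I i) b with hu
  let b' : Fin m → ℝ := fun a => if a ∈ I i then 0 else b a
  have hb'j : ∀ j, j ≠ i → groupMap X (I j) b' = groupMap X (I j) b := fun j hj =>
    groupMap_congr fun a ha => if_neg (Finset.disjoint_left.mp (hdisj j i hj) ha)
  have hb'i : groupMap X (I i) b' = 0 := by
    rw [← map_zero (groupMap X (I i))]
    exact groupMap_congr fun a ha => if_pos ha
  have hfit : designMap X b = designMap X b' + u := by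
    rw [designMap_eq_sum hdisj hcover, designMap_eq_sum hdisj hcover,
      ← Finset.add_sum_erase _ _ (Finset.mem_univ i), ← Finset.add_sum_erase _ _ (Finset.mem_univ i),
      hb'i, zero_add, add_comm]
    congr 1
    exact Finset.sum_congr rfl fun j hj => (hb'j j (Finset.ne_of_mem_erase hj)).symm
  have hinner : inner ℝ (designMap X b') u = 0 := by
    rw [designMap_eq_sum hdisj hcover, sum_inner]
    refine Finset.sum_eq_zero fun j _ => ?_
    by_cases hj : j = i
    · rw [hj, hb'i, inner_zero_left]
    · exact inner_groupMap_eq_zero horth hj _ _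
  have hupos : 0 < ‖u‖ := lt_of_le_of_ne (norm_nonneg _) (Ne.symm hi)
  have hupd : (fun j => w j * groupNorm X I b' j)
      = Function.update (fun j => w j * groupNorm X I b j) i 0 := by
    funext j
    by_cases hj : j = i
    · subst hj
      simp [groupNorm_eq, hb'i]
    · simp [groupNorm_eq, hj, hb'j j hj]
  have hcard : (Finset.univ.filter fun j => w j * groupNorm X I b j ≠ 0).card
      = {j | groupNorm X I b j ≠ 0}.ncard := by
    rw [← Set.ncard_coe_finset]
    congr 1
    ext j
    simp [(hw j).ne']
  have hpen := sortedPenalty_update_zero_add_le hlam (v := fun j => w j * groupNorm X I b j)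
    (fun j => mul_nonneg (hw j).le (groupNorm_nonneg b j)) (i := i) (mul_ne_zero (hw i).ne' hi)
  rw [← hupd, hcard] at hpen
  have hpen' := mul_le_mul_of_nonneg_left hpen hσ.le
  have hopt := hb b'
  rw [objective_eq, objective_eq, hfit] at hopt
  have hexp : ‖y - (designMap X b' + u)‖ ^ 2
      = ‖y - designMap X b'‖ ^ 2 - 2 * inner ℝ y u + ‖u‖ ^ 2 := by
    rw [← sub_sub, norm_sub_sq_real, inner_sub_left, hinner, sub_zero]
  have hproj : inner ℝ y u ≤ ‖(groupSpace X (I i)).orthogonalProjectionOnto y‖ * ‖u‖ := by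
    have h1 := Submodule.inner_orthogonalProjectionOnto_eq_of_mem_right
      (⟨u, b, rfl⟩ : groupSpace X (I i)) y
    have h2 := real_inner_le_norm ((groupSpace X (I i)).orthogonalProjectionOnto y)
      (⟨u, b, rfl⟩ : groupSpace X (I i))
    rw [h1] at h2
    exact h2
  rw [hexp] at hopt
  have hgn : groupNorm X I b i = ‖u‖ := rfl
  rw [hgn] at hpen'
  -- Optimality gives `σ w_i lam_R ‖u‖ + ‖u‖ ^ 2 / 2 ≤ ⟪y, u⟫`, with `R` the number of selected
  -- groups. The square makes the inequality strict after cancelling `‖u‖`.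
  refine lt_of_mul_lt_mul_right ?_ hupos.le
  nlinarith [pow_pos hupos 2]

end Solutions

/-! ### False selections and exceedances of the noise -/

section FalseSelections

variable {n m t : ℕ} {X : Matrix (Fin n) (Fin m) ℝ} {I : Fin t → Finset (Fin m)}
  {w : Fin t → ℝ} {σ α : ℝ} {k M : ℕ}

/-- The groups without effect under `β`. -/
noncomputable def nullGroups (X : Matrix (Fin n) (Fin m) ℝ) (I : Fin t → Finset (Fin m))
    (β : Fin m → ℝ) : Finset (Fin t) :=
  {i | groupNorm X I β i = 0}

/-- The threshold for null group `i` when `r` null groups are selected. -/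
noncomputable def nullThreshold (X : Matrix (Fin n) (Fin m) ℝ) (I : Fin t → Finset (Fin m))
    (k M : ℕ) (α : ℝ) (β : Fin m → ℝ) (i : nullGroups X I β) (r : ℕ) : ℝ :=
  chiQuantile (groupMatrix X (I i)).rank
    (1 - stepdownLevel k M α (t - (nullGroups X I β).card + r))

/-- The noise vectors for which, for some `r ≥ k`, at least `r` null groups exceed their
thresholds at `r`. -/
def exceedSet (X : Matrix (Fin n) (Fin m) ℝ) (I : Fin t → Finset (Fin m))
    (k M : ℕ) (α : ℝ) (β : Fin m → ℝ) : Set (EuclideanSpace ℝ (Fin n)) :=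
  {x | ∃ r ∈ Finset.Icc k (nullGroups X I β).card,
    r ≤ exceedCount (nullThreshold X I k M α β) Finset.univ
      (fun i => ‖(groupSpace X (I i)).orthogonalProjectionOnto x‖) r}

theorem card_nullGroups_le (β : Fin m → ℝ) : (nullGroups X I β).card ≤ t := by
  simpa using Finset.card_le_univ (nullGroups X I β)

theorem measurableSet_exceedSet (β : Fin m → ℝ) : MeasurableSet (exceedSet X I k M α β) := by
  have : exceedSet X I k M α β = ⋃ r ∈ Finset.Icc k (nullGroups X I β).card,
      {x | r ≤ exceedCount (nullThreshold X I k M α β) Finset.univ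
        (fun i => ‖(groupSpace X (I i)).orthogonalProjectionOnto x‖) r} := by
    ext x
    simp [exceedSet]
  rw [this]
  refine Finset.measurableSet_biUnion _ fun r _ => measurableSet_le measurable_const ?_
  exact (measurable_exceedCount _ r).comp (by fun_prop)

/-- Simes' inequality for the null groups with slope `a = α / (2N)`. -/
theorem stdGaussian_exceedSet_le (horth : OrthogonalGroups X I) (hk : 1 ≤ k) (hkt : k ≤ t)
    (hM : t ≤ M) (hα0 : 0 < α) (hα1 : α < 1) (β : Fin m → ℝ) :
    (stdGaussian (EuclideanSpace ℝ (Fin n))).real (exceedSet X I k M α β) ≤ α / 2 := by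
  set N := (nullGroups X I β).card with hN
  have hNt : N ≤ t := card_nullGroups_le β
  have hind : iIndepFun (fun (i : nullGroups X I β) x =>
      ‖(groupSpace X (I i)).orthogonalProjectionOnto x‖)
      (stdGaussian (EuclideanSpace ℝ (Fin n))) :=
    (iIndepFun_orthogonalProjectionOnto (fun i : nullGroups X I β => groupSpace X (I i))
      fun i j hij => isOrtho_groupSpace horth fun h => hij (Subtype.ext h)).comp
      (fun _ v => ‖v‖) fun _ => measurable_norm
  have h := measureReal_exists_le_exceedCount_le (K := Finset.Icc k N)
    (c := nullThreshold X I k M α β) (a := α / (2 * N)) (fun i => by fun_prop) hind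
    (by simp; omega) ?_ (by positivity) ?_
  · refine h.trans ?_
    rw [Fintype.card_coe, ← hN]
    -- Without null groups `a` is a division by zero, but the factor `N = 0` removes it.
    rcases Nat.eq_zero_or_pos N with h0 | h0
    · rw [h0, Nat.cast_zero, zero_mul]
      exact (half_pos hα0).le
    · have : (0 : ℝ) < N := by exact_mod_cast h0
      exact le_of_eq (by field_simp)
  · intro i r hr q hq hrq
    have hq' : q ≤ N := (Finset.mem_Icc.mp hq).2
    refine chiQuantile_mono _ ?_ ?_ ?_
    · linarith [stepdownLevel_le hk hkt hM hα0 (show t - N + q ≤ t by omega)]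
    · linarith [stepdownLevel_mono hk hM hα0 (show t - N + r ≤ t - N + q by omega)
        (show t - N + q ≤ t by omega)]
    · linarith [stepdownLevel_pos hk hkt hM hα0 (show t - N + r ≤ t by omega)]
  · intro i r hr
    obtain ⟨hkr, hrN⟩ := Finset.mem_Icc.mp hr
    refine le_trans ?_ (stepdownLevel_le_simes hk hM hα0 (show (t - N) + N = t by omega) hkr hrN)
    have hlaw : (stdGaussian (EuclideanSpace ℝ (Fin n))).map
        (fun x => ‖(groupSpace X (I i)).orthogonalProjectionOnto x‖)
        = chiMeasure (groupMatrix X (I i)).rank := by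
      rw [← finrank_groupSpace, ← stdGaussian_map_norm,
        ← stdGaussian_map_orthogonalProjectionOnto, Measure.map_map (by fun_prop) (by fun_prop)]
      rfl
    have h2 := measureReal_Ioi_chiQuantile_le (groupMatrix X (I i)).rank
      (stepdownLevel_pos hk hkt hM hα0 (show t - N + r ≤ t by omega))
    rw [← hlaw, map_measureReal_apply (by fun_prop) measurableSet_Ioi] at h2
    exact h2

/-- The witness is the number of false selections. At most `t - N` other groups are selected, with
`N` the number of null groups, so monotonicity of `λ` replaces the total number of selections by an
index depending on the false ones only. -/
theorem mem_exceedSet_of_isSolution (hdisj : ∀ i j, i ≠ j → Disjoint (I i) (I j))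
    (hcover : ∀ a : Fin m, ∃ i, a ∈ I i) (horth : OrthogonalGroups X I) (hw : ∀ i, 0 < w i)
    (hσ : 0 < σ) (hk : 1 ≤ k) (hkt : k ≤ t) (hM : t ≤ M) (hα0 : 0 < α) (hα1 : α < 1)
    {β b : Fin m → ℝ} {x : EuclideanSpace ℝ (Fin n)}
    (hb : IsSolution X I w σ (lambdaGk X I w k M α) (designMap X β + σ • x) b)
    (hV : k ≤ falseGroups X I β b) : x ∈ exceedSet X I k M α β := by
  classical
  set N := nullGroups X I β with hN
  let S : Finset (Fin t) := {i | groupNorm X I b i ≠ 0}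
  let F : Finset (Fin t) := {i | groupNorm X I β i = 0 ∧ groupNorm X I b i ≠ 0}
  have hS : {j | groupNorm X I b j ≠ 0}.ncard = S.card := by
    rw [← Set.ncard_coe_finset]
    simp [S]
  have hF : falseGroups X I β b = F.card := by
    rw [falseGroups, ← Set.ncard_coe_finset]
    simp [F]
  have hFN : F ⊆ N := fun i hi => by
    simp only [F, Finset.mem_filter] at hi
    simp [hN, nullGroups, hi.2.1]
  have hSF : S.card ≤ t - N.card + F.card := by
    have h1 : S ⊆ Nᶜ ∪ F := fun i hi => by
      simp only [S, Finset.mem_filter] at hi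
      by_cases h : groupNorm X I β i = 0
      · simp [F, h, hi.2]
      · simp [hN, nullGroups, h]
    refine (Finset.card_le_card h1).trans ((Finset.card_union_le _ _).trans ?_)
    rw [Finset.card_compl, Fintype.card_fin]
  have hFc : F.card ≤ N.card := Finset.card_le_card hFN
  have hNt : N.card ≤ t := card_nullGroups_le β
  refine ⟨F.card, Finset.mem_Icc.mpr ⟨hF ▸ hV, hFc⟩, ?_⟩
  have hcardF : F.card = (F.subtype (· ∈ N)).card := by
    rw [Finset.card_subtype, Finset.filter_true_of_mem fun i hi => hFN hi]
  rw [exceedCount]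
  conv_lhs => rw [hcardF]
  refine Finset.card_le_card fun i hi => ?_
  rw [Finset.mem_subtype] at hi
  simp only [F, Finset.mem_filter, Finset.mem_univ, true_and] at hi
  obtain ⟨hβi, hbi⟩ := hi
  have hS1 : 1 ≤ S.card := Finset.card_pos.mpr ⟨i, by simpa [S] using hbi⟩
  have h1 := lt_norm_orthogonalProjectionOnto_of_isSolution hdisj hcover horth hw hσ
    (lambdaGk_decreasing hw hk hkt hM hα0 hα1) hb hbi
  have h2 : (groupSpace X (I i)).orthogonalProjectionOnto (designMap X β + σ • x)
      = σ • (groupSpace X (I i)).orthogonalProjectionOnto x := by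
    -- The signal has no component in a null group.
    have h0 : (groupSpace X (I i)).orthogonalProjectionOnto (designMap X β) = 0 := by
      rw [← norm_eq_zero, Submodule.coe_norm,
        orthogonalProjectionOnto_designMap hdisj hcover horth]
      exact hβi
    rw [map_add, h0, zero_add, map_smul]
  rw [h2, norm_smul, Real.norm_of_nonneg hσ.le, hS] at h1
  have h3 := lt_of_mul_lt_mul_left h1 hσ.le
  have h4 := lambdaGk_decreasing (X := X) (I := I) (w := w) hw hk hkt hM hα0 hα1 _ _ hS1 hSF
    (by omega)
  have h5 := chiQuantile_le_mul_lambdaGk (X := X) (I := I) (w := w) (k := k) (M := M) (α := α) hw i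
    (t - N.card + F.card)
  rw [Finset.mem_filter]
  exact ⟨Finset.mem_univ _,
    (h5.trans (mul_le_mul_of_nonneg_left h4 (hw i).le)).trans_lt h3⟩

end FalseSelections

end GroupSlope

theorem mainTheorem3 {n m t : ℕ}
    -- design matrix and a partition of its columns into `t` nonempty, mutually orthogonal groups
    (X : Matrix (Fin n) (Fin m) ℝ) (I : Fin t → Finset (Fin m))
    (hI_nonempty : ∀ i, (I i).Nonempty)
    (hI_disjoint : ∀ i j, i ≠ j → Disjoint (I i) (I j))
    (hI_cover : ∀ a : Fin m, ∃ i, a ∈ I i)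
    (horth : ∀ i j, i ≠ j →
      (GroupSlope.groupMatrix X (I i))ᵀ * GroupSlope.groupMatrix X (I j) = 0)
    -- weights, noise level, and the parameters of the error rate
    (w : Fin t → ℝ) (hw : ∀ i, 0 < w i)
    (σ : ℝ) (hσ : 0 < σ)
    (k : ℕ) (hk : 1 ≤ k) (hkt : k ≤ t)
    (α : ℝ) (hα0 : 0 < α) (hα1 : α < 1)
    -- the total count in the stepdown levels; `M = m` and `M = t` are both allowed
    (M : ℕ) (hM : t ≤ M)
    -- the linear model `y = X β + ε` with `ε ∼ N(0, σ² I_n)`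
    {Ω : Type*} [MeasurableSpace Ω] (P : Measure Ω) [IsProbabilityMeasure P]
    (β : Fin m → ℝ) (ε : Ω → EuclideanSpace ℝ (Fin n))
    (hε : HasLaw ε (multivariateGaussian 0 ((σ ^ 2) • (1 : Matrix (Fin n) (Fin n) ℝ))) P) :
    -- solutions exist, and all of them have the same vector of group norms
    (∀ y : EuclideanSpace ℝ (Fin n),
      (∃ b, GroupSlope.IsSolution X I w σ (GroupSlope.lambdaGk X I w k M α) y b) ∧
      ∀ b b', GroupSlope.IsSolution X I w σ (GroupSlope.lambdaGk X I w k M α) y b →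
        GroupSlope.IsSolution X I w σ (GroupSlope.lambdaGk X I w k M α) y b' →
        GroupSlope.groupNorm X I b = GroupSlope.groupNorm X I b') ∧
    -- for every choice of solutions, the group k-FWER is below `α`
    ∀ bhat : Ω → Fin m → ℝ,
      (∀ ω, GroupSlope.IsSolution X I w σ (GroupSlope.lambdaGk X I w k M α)
        (WithLp.toLp 2 (X *ᵥ β) + ε ω) (bhat ω)) →
      P {ω | k ≤ GroupSlope.falseGroups X I β (bhat ω)} < ENNReal.ofReal α := by

  have hlam := GroupSlope.lambdaGk_decreasing (X := X) (I := I) hw hk hkt hM hα0 hα1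
  have hlam0 : ∀ i, 1 ≤ i → i ≤ t → 0 ≤ GroupSlope.lambdaGk X I w k M α i :=
    fun _ _ hi => GroupSlope.lambdaGk_nonneg hw hk hkt hM hα0 hα1 hi
  refine ⟨fun y => ⟨GroupSlope.exists_isSolution hI_disjoint hI_cover horth hw hσ hlam hlam0 y,
    fun b b' hb hb' => GroupSlope.groupNorm_eq_of_isSolution hI_disjoint hI_cover horth hw hσ hlam
      hlam0 hb hb'⟩, fun bhat hbhat => ?_⟩
  -- No measurability of `bhat` is assumed, so the event is enclosed in a measurable event of the
  -- noise. Dividing by `σ` turns the noise into a standard Gaussian vector.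
  let B := (fun z => σ⁻¹ • z) ⁻¹' GroupSlope.exceedSet X I k M α β
  have hmeas := GroupSlope.measurableSet_exceedSet (X := X) (I := I) (k := k) (M := M) (α := α) β
  have hB : MeasurableSet B := (measurable_const_smul σ⁻¹) hmeas
  have hsub : {ω | k ≤ GroupSlope.falseGroups X I β (bhat ω)} ⊆ ε ⁻¹' B := by
    intro ω hω
    refine GroupSlope.mem_exceedSet_of_isSolution hI_disjoint hI_cover horth hw hσ hk hkt hM hα0
      hα1 (b := bhat ω) ?_ hω
    rw [smul_inv_smul₀ hσ.ne']
    exact hbhat ω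
  calc P {ω | k ≤ GroupSlope.falseGroups X I β (bhat ω)} ≤ P (ε ⁻¹' B) := measure_mono hsub
    _ = stdGaussian (EuclideanSpace ℝ (Fin n)) (GroupSlope.exceedSet X I k M α β) := by
        rw [← Measure.map_apply_of_aemeasurable hε.aemeasurable hB, hε.map_eq,
          GroupSlope.multivariateGaussian_smul_one,
          Measure.map_apply (measurable_const_smul σ) hB, ← Set.preimage_comp]
        congr 1
        ext x
        simp [smul_smul, inv_mul_cancel₀ hσ.ne']
    _ ≤ ENNReal.ofReal (α / 2) := by
        rw [← ofReal_measureReal]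
        exact ENNReal.ofReal_le_ofReal
          (GroupSlope.stdGaussian_exceedSet_le horth hk hkt hM hα0 hα1 β)
    _ < ENNReal.ofReal α := (ENNReal.ofReal_lt_ofReal_iff hα0).mpr (by linarith)
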